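/- Let $p$ be a prime number, let $i\ge 1$ be an integer, and let $K=\mathbf{F}_{p^i}(\!(T)\!)$ be the field of formal Laurent series in one variable over the finite field with $p^i$ elements. Let $q$ be a prime number and let $a\in\mathbf{N}$ (with $a=0$ allowed). There exists a subfield $K'\subseteq K$ such that the extension $K/K'$ is finite Galois and $q^a$ divides the degree $[K:K']$ if and only if $q=p$ or $q^a$ divides $i(p^i-1)$. -/

import Mathlib

/-!
Let `k` be the finite field with `p ^ i` elements. By Galois theory, the degrees of the finite
Galois extensions `k⸨X⸩ / K'` are the orders of the finite groups of field automorphisms of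
`k⸨X⸩`. Every such automorphism preserves `k⟦X⟧` (`LaurentSeries.map_mem_range`): the divisibility
of the principal units singles out the elements of order zero. So the question is about finite
subgroups of `RingAut k⟦X⟧`.

For a subgroup `H` of order prime to `p` (`card_dvd_of_ringAut_powerSeries`), the ramification
filtration gives the bound. The image of `H` in the automorphism group of the residue field has
order dividing `i`; on the kernel, `σ ↦ σ X / X mod X` is a homomorphism to `kˣ`, a group of order
`p ^ i - 1`; and this homomorphism is injective, because no nontrivial element of its kernel has finite
order prime to `p` (`ringAut_eq_one_of_pow_eq_one`). Conversely, the semidirect product of `kˣ` and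
`RingAut k` acts faithfully by scaling `X` and acting on coefficients (`tameAut`), so the order
`i * (p ^ i - 1)` occurs.

For `q = p`, let `V` be the additive group of polynomials over `k` of degree less than `a`. There
is a power series `t` with `∏ v : V, (1 / X - v(t)) = 1 / t` (`exists_wildNorm_X_eq`), found as the
fixed point of an `X`-adic contraction, and it is unique. Since the product is invariant under the
translations of `1 / X` by the `v(t)`, the substitutions `1 / X ↦ 1 / X + v(t)` fix `t`
(`wildHom_fixed`). They therefore compose additively, and make `V` act faithfully on `k⟦X⟧`
(`wildEnd`), so that the order `p ^ (i * a)` occurs.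
-/

open PowerSeries

/-! ### Automorphisms of a Laurent series field -/

theorem LaurentSeries.ringAut_ext {k : Type*} [Field k] {σ τ : RingAut (LaurentSeries k)}
    (h : ∀ f : k⟦X⟧, σ (algebraMap _ _ f) = τ (algebraMap _ _ f)) : σ = τ := by
  apply RingEquiv.toRingHom_injective
  apply IsLocalization.ringHom_ext (nonZeroDivisors k⟦X⟧)
  ext f : 1
  exact h f

/-- The extension of a ring automorphism of `k⟦X⟧` to the fraction field `k⸨X⸩`. -/
noncomputable def laurentAut (k : Type*) [Field k] :
    RingAut k⟦X⟧ →* RingAut (LaurentSeries k) where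
  toFun σ := IsFractionRing.ringEquivOfRingEquiv σ
  map_one' := LaurentSeries.ringAut_ext fun f => IsFractionRing.ringEquivOfRingEquiv_algebraMap _ f
  map_mul' σ τ := LaurentSeries.ringAut_ext fun f => by
    simp only [RingAut.mul_apply, IsFractionRing.ringEquivOfRingEquiv_algebraMap]

@[simp]
theorem laurentAut_algebraMap {k : Type*} [Field k] (σ : RingAut k⟦X⟧) (f : k⟦X⟧) :
    laurentAut k σ (algebraMap k⟦X⟧ (LaurentSeries k) f) = algebraMap _ _ (σ f) :=
  IsFractionRing.ringEquivOfRingEquiv_algebraMap _ f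

theorem laurentAut_injective (k : Type*) [Field k] : Function.Injective (laurentAut k) := by
  intro σ τ h
  ext1 f
  apply IsFractionRing.injective k⟦X⟧ (LaurentSeries k)
  rw [← laurentAut_algebraMap, ← laurentAut_algebraMap, h]

/-- A power series with constant term `1` has an `n`-th root for every `n` invertible in `k`,
by Hensel's lemma. -/
theorem PowerSeries.exists_pow_eq_one_add_X_mul {k : Type*} [Field k] {n : ℕ} (hn : (n : k) ≠ 0)
    (f : k⟦X⟧) : ∃ g : k⟦X⟧, g ^ n = 1 + X * f := by
  have hn0 : n ≠ 0 := by rintro rfl; simp at hn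
  obtain ⟨g, hg, -⟩ := HenselianRing.is_henselian (I := Ideal.span {(X : k⟦X⟧)})
    (Polynomial.X ^ n - Polynomial.C (1 + X * f)) (Polynomial.monic_X_pow_sub_C _ hn0) 1
    (by simp [Ideal.mem_span_singleton]) (by
      have : IsUnit (n : k⟦X⟧) := by
        rw [PowerSeries.isUnit_iff_constantCoeff]; simpa using hn
      simpa [Polynomial.derivative_X_pow] using
        this.map (Ideal.Quotient.mk (Ideal.span {(X : k⟦X⟧)})))
  exact ⟨g, by simpa [Polynomial.IsRoot, sub_eq_zero] using hg⟩

theorem LaurentSeries.mem_range_of_order_nonneg {k : Type*} [Field k] {x : LaurentSeries k}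
    (hx : 0 ≤ x.order) : ∃ f : k⟦X⟧, algebraMap _ (LaurentSeries k) f = x := by
  obtain ⟨n, hn⟩ := Int.eq_ofNat_of_zero_le hx
  exact ⟨_, LaurentSeries.X_order_mul_powerSeriesPart (f := x) hn.symm⟩

/-- An element of `k⸨X⸩` which is an `n`-th power for infinitely many `n` has order zero, because
`n` divides its order. -/
theorem LaurentSeries.order_eq_zero_of_pow {k : Type*} [Field k] {z : LaurentSeries k}
    {p : ℕ} (hp : 0 < p) (h : ∀ m : ℕ, ∃ y : LaurentSeries k, y ^ (p * m + 1) = z) :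
    z.order = 0 := by
  obtain ⟨y, hy⟩ := h z.order.natAbs
  have h1 := congrArg HahnSeries.order hy
  rw [HahnSeries.order_pow, nsmul_eq_mul] at h1
  apply Int.eq_zero_of_abs_lt_dvd (Dvd.intro _ h1)
  push_cast
  have : (1 : ℤ) ≤ p := by exact_mod_cast hp
  rw [Int.abs_eq_natAbs]
  nlinarith [Int.natCast_nonneg z.order.natAbs]

/-- Every ring automorphism of `k⸨X⸩`, `k` finite, preserves `k⟦X⟧`: the elements
`1 + X h` are `n`-th powers for all `n` prime to the characteristic and the nonzero constants are
roots of unity, so that the images of both have order zero. -/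
theorem LaurentSeries.map_mem_range {k : Type*} [Field k] [Finite k]
    (σ : RingAut (LaurentSeries k)) (f : k⟦X⟧) :
    ∃ g : k⟦X⟧, algebraMap _ (LaurentSeries k) g = σ (algebraMap _ _ f) := by
  obtain ⟨p, _⟩ := CharP.exists k
  have hp : 0 < p := (CharP.char_is_prime k p).pos
  -- write `f = c + X h`
  obtain ⟨h, hh⟩ : X ∣ f - C (constantCoeff f) := by simp [X_dvd_iff]
  obtain ⟨g₁, hg₁⟩ : ∃ g : k⟦X⟧, algebraMap _ (LaurentSeries k) g =
      σ (algebraMap _ _ (1 + X * h)) := by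
    apply mem_range_of_order_nonneg
    apply le_of_eq
    symm
    apply order_eq_zero_of_pow hp
    intro m
    obtain ⟨g, hg⟩ := PowerSeries.exists_pow_eq_one_add_X_mul (k := k) (n := p * m + 1)
      (by simp) h
    exact ⟨σ (algebraMap _ _ g), by rw [← hg, map_pow, map_pow]⟩
  obtain ⟨g₂, hg₂⟩ : ∃ g : k⟦X⟧, algebraMap _ (LaurentSeries k) g =
      σ (algebraMap _ _ (C (constantCoeff f))) := by
    apply mem_range_of_order_nonneg
    apply le_of_eq
    set z := σ (algebraMap _ _ (C (constantCoeff f))) with hz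
    have h1 : z ^ Nat.card k = z := by
      have := Fintype.ofFinite k
      rw [hz, ← map_pow, ← map_pow, ← map_pow, Nat.card_eq_fintype_card, FiniteField.pow_card]
    have h2 := congrArg HahnSeries.order h1
    rw [HahnSeries.order_pow, nsmul_eq_mul] at h2
    have h3 : (1 : ℤ) < Nat.card k := by exact_mod_cast Finite.one_lt_card
    rcases mul_left_eq_self₀.mp h2 with h4 | h4
    · omega
    · exact h4.symm
  refine ⟨g₁ - 1 + g₂, ?_⟩
  rw [map_add, map_sub, hg₁, hg₂, map_one, ← map_one σ, ← map_sub, ← map_add,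
    ← map_one (algebraMap k⟦X⟧ (LaurentSeries k)), ← map_sub, ← map_add]
  congr 2
  linear_combination -hh

theorem laurentAut_surjective (k : Type*) [Field k] [Finite k] :
    Function.Surjective (laurentAut k) := by
  intro σ
  have inj := IsFractionRing.injective k⟦X⟧ (LaurentSeries k)
  choose a ha using LaurentSeries.map_mem_range σ
  choose b hb using LaurentSeries.map_mem_range σ.symm
  let τ : RingAut k⟦X⟧ :=
    { toFun := a
      invFun := b
      left_inv f := inj (by rw [hb, ha, RingEquiv.symm_apply_apply])
      right_inv f := inj (by rw [ha, hb, RingEquiv.apply_symm_apply])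
      map_mul' f g := inj (by simp only [ha, map_mul])
      map_add' f g := inj (by simp only [ha, map_add]) }
  refine ⟨τ, ?_⟩
  exact LaurentSeries.ringAut_ext fun f => (laurentAut_algebraMap τ f).trans (ha f)

/-- For finite `k`, passage to the fraction field identifies the ring automorphisms of `k⟦X⟧`
and of `k⸨X⸩`. -/
noncomputable def laurentAutEquiv (k : Type*) [Field k] [Finite k] :
    RingAut k⟦X⟧ ≃* RingAut (LaurentSeries k) :=
  MulEquiv.ofBijective (laurentAut k) ⟨laurentAut_injective k, laurentAut_surjective k⟩

/-- Artin's theorem: a finite group of automorphisms of `k⟦X⟧` is the Galois group of `k⸨X⸩`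
over its fixed field. -/
theorem exists_subfield_finrank_eq_card {k : Type*} [Field k] {G : Type*} [Group G] [Finite G]
    (φ : G →* RingAut k⟦X⟧) (hφ : Function.Injective φ) :
    ∃ K' : Subfield (LaurentSeries k), FiniteDimensional K' (LaurentSeries k) ∧
      IsGalois K' (LaurentSeries k) ∧ Module.finrank K' (LaurentSeries k) = Nat.card G := by
  have := Fintype.ofFinite G
  let _ : MulSemiringAction G (LaurentSeries k) :=
    MulSemiringAction.compHom _ ((laurentAut k).comp φ)
  have : FaithfulSMul G (LaurentSeries k) :=
    ⟨fun {g h} H => hφ (laurentAut_injective k (RingEquiv.ext H))⟩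
  refine ⟨FixedPoints.subfield G (LaurentSeries k), inferInstance, ⟨⟩, ?_⟩
  rw [FixedPoints.finrank_eq_card, Nat.card_eq_fintype_card]

/-! ### Finite groups of automorphisms of order prime to the characteristic -/

theorem card_ringAut_of_card_eq_pow {k : Type*} [Field k] [Finite k] {p : ℕ} [Fact p.Prime]
    {i : ℕ} (h : Nat.card k = p ^ i) : Nat.card (RingAut k) = i := by
  have hi : i ≠ 0 := by
    rintro rfl
    have := Finite.one_lt_card (α := k)
    simp [h] at this
  have : CharP k p := by
    have := Fintype.ofFinite k
    refine charP_of_card_eq_prime_pow (f := i) ?_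
    rw [← Nat.card_eq_fintype_card, h]
  let _ := ZMod.algebra k p
  have e : RingAut k ≃ (k ≃ₐ[ZMod p] k) :=
    { toFun σ := AlgEquiv.ofRingEquiv (f := σ) fun x =>
        RingHom.congr_fun (Subsingleton.elim ((σ : k →+* k).comp (algebraMap (ZMod p) k)) _) x
      invFun τ := τ.toRingEquiv
      left_inv _ := rfl
      right_inv _ := rfl }
  rw [Nat.card_congr e, IsGalois.card_aut_eq_finrank]
  apply Nat.pow_right_injective (Fact.out : p.Prime).two_le
  simpa [h] using (Module.natCard_eq_pow_finrank (K := ZMod p) (V := k)).symm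

theorem constantCoeff_eq_of_mem_ker_mapAut {k : Type*} [Field k] {σ : RingAut k⟦X⟧}
    (hσ : IsLocalRing.ResidueField.mapAut σ = 1) (f : k⟦X⟧) :
    constantCoeff (σ f) = constantCoeff f := by
  have h : IsLocalRing.residue _ (σ f) = IsLocalRing.residue _ f :=
    RingEquiv.congr_fun hσ (IsLocalRing.residue _ f)
  have h2 := Ideal.Quotient.eq.mp h
  rwa [PowerSeries.maximalIdeal_eq_span_X, Ideal.mem_span_singleton, X_dvd_iff, map_sub,
    sub_eq_zero] at h2

theorem constantCoeff_ringAut_X {k : Type*} [Field k] (σ : RingAut k⟦X⟧) :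
    constantCoeff (σ X) = 0 := by
  by_contra h
  have h2 : IsUnit (σ X) := by
    rw [PowerSeries.isUnit_iff_constantCoeff]
    exact isUnit_iff_ne_zero.mpr h
  have h3 : IsUnit (X : k⟦X⟧) := by simpa using h2.map σ.symm
  simp [PowerSeries.isUnit_iff_constantCoeff] at h3

/-- On automorphisms acting trivially on the residue field, the leading coefficient of the image
of the uniformizer `X` is multiplicative. -/
noncomputable def tameCharacter (k : Type*) [Field k] :
    (IsLocalRing.ResidueField.mapAut (R := k⟦X⟧)).ker →* k where
  toFun σ := coeff 1 (σ.1 X)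
  map_one' := by simp
  map_mul' σ τ := by
    obtain ⟨u, hu⟩ := X_dvd_iff.mpr (constantCoeff_ringAut_X τ.1)
    obtain ⟨w, hw⟩ := X_dvd_iff.mpr (constantCoeff_ringAut_X σ.1)
    have h := constantCoeff_eq_of_mem_ker_mapAut σ.2 u
    simp [RingAut.mul_apply, hu, hw, mul_assoc, coeff_succ_X_mul 0, h]

/-- If `σ` acts trivially on the residue field and `σ X ≡ X mod X ^ 2`, then `σ f / f` is a
principal unit for every nonzero `f`. -/
theorem exists_ringAut_eq_mul_one_add {k : Type*} [Field k] {σ : RingAut k⟦X⟧}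
    (hσ : IsLocalRing.ResidueField.mapAut σ = 1) (h1 : coeff 1 (σ X) = 1) (f : k⟦X⟧) :
    ∃ g, σ f = f * (1 + X * g) := by
  by_cases hf : f = 0
  · exact ⟨0, by simp [hf]⟩
  -- write `f = X ^ n * w` with `w` a unit, and `σ X = X * u`
  obtain ⟨n, w, rfl⟩ : ∃ n : ℕ, ∃ w : (k⟦X⟧)ˣ, f = X ^ n * (w : k⟦X⟧) := by
    refine ⟨f.order.toNat, Unit_of_divided_by_X_pow_order f, ?_⟩
    rw [Unit_of_divided_by_X_pow_order_nonzero hf]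
    exact X_pow_order_mul_divXPowOrder.symm
  obtain ⟨u, hu⟩ := X_dvd_iff.mpr (constantCoeff_ringAut_X σ)
  have hu1 : constantCoeff u = 1 := by simpa [hu, coeff_succ_X_mul 0] using h1
  have hw := constantCoeff_eq_of_mem_ker_mapAut hσ (w : k⟦X⟧)
  have hw0 : constantCoeff (w : k⟦X⟧) * constantCoeff (↑w⁻¹ : k⟦X⟧) = 1 := by
    rw [← map_mul, Units.mul_inv, map_one]
  obtain ⟨g, hg⟩ : X ∣ u ^ n * σ w * (↑w⁻¹ : k⟦X⟧) - 1 := by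
    rw [X_dvd_iff, map_sub, map_mul, map_mul, map_pow, hu1, hw, one_pow, one_mul, hw0, map_one,
      sub_self]
  refine ⟨g, ?_⟩
  rw [← hg, map_mul, map_pow, hu]
  linear_combination (-X ^ n * u ^ n * σ w) * w.mul_inv

/-- Wild inertia has no elements of order prime to the characteristic: for `d = σ f - f`, the sum
of `σ ^ j d` over a period `N` telescopes to zero, but is congruent to `N d` modulo `X d`. -/
theorem ringAut_eq_one_of_pow_eq_one {k : Type*} [Field k] {σ : RingAut k⟦X⟧}
    (hσ : IsLocalRing.ResidueField.mapAut σ = 1) (h1 : coeff 1 (σ X) = 1) {N : ℕ}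
    (hN : (N : k) ≠ 0) (hpow : σ ^ N = 1) : σ = 1 := by
  ext1 f
  rw [RingAut.one_apply, ← sub_eq_zero]
  set d := σ f - f with hd
  have hj : ∀ j : ℕ, ∃ g, (σ ^ j) d = d * (1 + X * g) := by
    intro j
    induction j with
    | zero => exact ⟨0, by simp⟩
    | succ j ih =>
      obtain ⟨g, hg⟩ := ih
      obtain ⟨g', hg'⟩ := exists_ringAut_eq_mul_one_add hσ h1 ((σ ^ j) d)
      refine ⟨g + g' + X * g * g', ?_⟩
      rw [pow_succ', RingAut.mul_apply, hg', hg]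
      ring
  choose g hg using hj
  have hsum : ∑ j ∈ Finset.range N, (σ ^ j) d = 0 := by
    have : ∀ j, (σ ^ j) d = (σ ^ (j + 1)) f - (σ ^ j) f := fun j => by
      rw [hd, map_sub, pow_succ, RingAut.mul_apply]
    rw [Finset.sum_congr rfl fun j _ => this j, Finset.sum_range_sub (fun j => (σ ^ j) f), hpow]
    simp
  have hsum2 : ∑ j ∈ Finset.range N, (σ ^ j) d =
      d * ((N : k⟦X⟧) + X * ∑ j ∈ Finset.range N, g j) := by
    rw [Finset.sum_congr rfl fun j _ => hg j, ← Finset.mul_sum, Finset.sum_add_distrib,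
      ← Finset.mul_sum]
    simp
  rw [hsum] at hsum2
  refine (mul_eq_zero.mp hsum2.symm).resolve_right fun h => hN ?_
  simpa using congrArg constantCoeff h

/-- The image of `H` in the automorphism group of the residue field has order dividing `i`, and the
tame character embeds the kernel in `kˣ`, as `H` meets wild inertia trivially. -/
theorem card_dvd_of_ringAut_powerSeries {k : Type*} [Field k] [Finite k] {p : ℕ} [Fact p.Prime]
    {i : ℕ} (hk : Nat.card k = p ^ i) {H : Subgroup (RingAut k⟦X⟧)} [Finite H]
    (hH : (Nat.card H : k) ≠ 0) : Nat.card H ∣ i * (p ^ i - 1) := by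
  set ρ := (IsLocalRing.ResidueField.mapAut (R := k⟦X⟧)).comp H.subtype with hρ
  have e : IsLocalRing.ResidueField k⟦X⟧ ≃+* k := residueFieldOfPowerSeries
  have : Finite (IsLocalRing.ResidueField k⟦X⟧) := Finite.of_equiv _ e.symm.toEquiv
  have hres : Nat.card (IsLocalRing.ResidueField k⟦X⟧) = p ^ i :=
    (Nat.card_congr e.toEquiv).trans hk
  have hrange : Nat.card ρ.range ∣ i := by
    rw [← card_ringAut_of_card_eq_pow hres]
    exact Subgroup.card_subgroup_dvd_card _
  let χ : ρ.ker →* kˣ := ((tameCharacter k).comp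
    ((H.subtype.comp ρ.ker.subtype).codRestrict _ fun σ => σ.2)).toHomUnits
  have hχ : Function.Injective χ := by
    refine (injective_iff_map_eq_one χ).mpr fun σ hσ => ?_
    have h1 : coeff 1 (σ.1.1 X) = 1 := congrArg Units.val hσ
    have h2 : (σ.1.1) = 1 := ringAut_eq_one_of_pow_eq_one σ.2 h1 hH
      (by rw [← Subgroup.coe_pow, pow_card_eq_one']; rfl)
    exact Subtype.ext (Subtype.ext h2)
  have hker : Nat.card ρ.ker ∣ p ^ i - 1 := by
    rw [← hk, ← Nat.card_units]
    exact Subgroup.card_dvd_of_injective χ hχ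
  rw [← ρ.ker.card_mul_index, Subgroup.index_ker, mul_comm]
  exact mul_dvd_mul hrange hker

/-- A subgroup of order `q ^ a` of the Galois group acts faithfully on `k⟦X⟧`, which bounds `a`. -/
theorem pow_dvd_of_isGalois {k : Type*} [Field k] [Finite k] {p : ℕ} [Fact p.Prime]
    {i : ℕ} (hk : Nat.card k = p ^ i) {q : ℕ} (hq : q.Prime) (hqp : q ≠ p) {a : ℕ}
    (K' : Subfield (LaurentSeries k)) [FiniteDimensional K' (LaurentSeries k)]
    [IsGalois K' (LaurentSeries k)] (h : q ^ a ∣ Module.finrank K' (LaurentSeries k)) :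
    q ^ a ∣ i * (p ^ i - 1) := by
  have : Fact q.Prime := ⟨hq⟩
  rw [← IsGalois.card_aut_eq_finrank] at h
  obtain ⟨H, hH⟩ := Sylow.exists_subgroup_card_pow_prime q h
  let ι : (LaurentSeries k ≃ₐ[K'] LaurentSeries k) →* RingAut k⟦X⟧ :=
    (laurentAutEquiv k).symm.toMonoidHom.comp (MulSemiringAction.toRingAut _ _)
  have hι : Function.Injective ι :=
    (laurentAutEquiv k).symm.injective.comp fun σ τ h => AlgEquiv.ext (RingEquiv.congr_fun h)
  have hcard : Nat.card (H.map ι) = q ^ a := by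
    rw [← hH]
    exact (Nat.card_congr (H.equivMapOfInjective ι hι).toEquiv).symm
  have : Finite (H.map ι) := Nat.finite_of_card_ne_zero (hcard ▸ pow_ne_zero _ hq.ne_zero)
  rw [← hcard]
  apply card_dvd_of_ringAut_powerSeries hk
  have : CharP k p := by
    have := Fintype.ofFinite k
    refine charP_of_card_eq_prime_pow (f := i) ?_
    rw [← Nat.card_eq_fintype_card, hk]
  rw [hcard, Nat.cast_pow]
  refine pow_ne_zero _ ?_
  rw [Ne, CharP.cast_eq_zero_iff k p]
  exact fun h => hqp ((Nat.prime_dvd_prime_iff_eq Fact.out hq).mp h).symm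

/-! ### A tame group of order `i * (p ^ i - 1)` -/

/-- The automorphism `X ↦ c X` of `k⟦X⟧`. -/
noncomputable def rescaleAut (k : Type*) [Field k] : kˣ →* RingAut k⟦X⟧ where
  toFun c := RingEquiv.ofRingHom (rescale (c : k)) (rescale (↑c⁻¹ : k))
    (by ext f : 1; simp [rescale_rescale]) (by ext f : 1; simp [rescale_rescale])
  map_one' := by ext f : 1; simp
  map_mul' c d := by ext f : 1; simp [rescale_rescale, mul_comm]

/-- The action of `RingAut k` on the coefficients of power series. -/
noncomputable def coeffAut (k : Type*) [Field k] : RingAut k →* RingAut k⟦X⟧ where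
  toFun s := RingEquiv.ofRingHom (PowerSeries.map (s : k →+* k))
    (PowerSeries.map (s.symm : k →+* k)) (by ext; simp) (by ext; simp)
  map_one' := by ext; simp
  map_mul' s s' := by ext; simp

/-- The natural action of ring automorphisms on the group of units. -/
def unitsAut (k : Type*) [Field k] : RingAut k →* MulAut kˣ where
  toFun s := Units.mapEquiv s.toMulEquiv
  map_one' := rfl
  map_mul' _ _ := rfl

/-- The group generated by `X ↦ c X` and the automorphisms of the coefficient field. -/
noncomputable def tameAut (k : Type*) [Field k] : kˣ ⋊[unitsAut k] RingAut k →* RingAut k⟦X⟧ :=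
  SemidirectProduct.lift (rescaleAut k) (coeffAut k) fun s => by
    ext c f n
    simp [rescaleAut, coeffAut, unitsAut, coeff_rescale, RingAut.inv_apply]

theorem tameAut_injective (k : Type*) [Field k] : Function.Injective (tameAut k) := by
  refine (injective_iff_map_eq_one _).mpr fun ⟨c, s⟩ h => ?_
  have h' : ∀ f, rescaleAut k c (coeffAut k s f) = f := RingEquiv.congr_fun h
  have hs : s = 1 := by
    ext x
    simpa [rescaleAut, coeffAut, -coeff_zero_eq_constantCoeff, coeff_rescale] using
      congrArg (coeff 0) (h' (C x))
  have hc : c = 1 := by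
    ext
    simpa [rescaleAut, coeffAut] using congrArg (coeff 1) (h' X)
  rw [hs, hc]
  rfl

theorem exists_subfield_finrank_eq_mul {k : Type*} [Field k] [Finite k] {p : ℕ} [Fact p.Prime]
    {i : ℕ} (hk : Nat.card k = p ^ i) :
    ∃ K' : Subfield (LaurentSeries k), FiniteDimensional K' (LaurentSeries k) ∧
      IsGalois K' (LaurentSeries k) ∧
      Module.finrank K' (LaurentSeries k) = i * (p ^ i - 1) := by
  have : Finite (RingAut k) := Finite.of_injective _ (DFunLike.coe_injective (F := k ≃+* k))
  have : Finite (kˣ ⋊[unitsAut k] RingAut k) := Finite.of_equiv _ SemidirectProduct.equivProd.symm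
  have h := exists_subfield_finrank_eq_card (tameAut k) (tameAut_injective k)
  rwa [SemidirectProduct.card, Nat.card_units, hk, card_ringAut_of_card_eq_pow hk, mul_comm] at h

/-! ### Large elementary abelian groups of wild automorphisms -/

/-- A fixed point theorem: `y ↦ c + X * h(y)` is a contraction for the `X`-adic topology. -/
theorem PowerSeries.exists_eq_add_X_mul_eval {k : Type*} [Field k] (c : k⟦X⟧)
    (h : Polynomial k⟦X⟧) : ∃ t, t = c + X * h.eval t := by
  let s : ℕ → k⟦X⟧ := fun m => (fun y => c + X * h.eval y)^[m] 0
  have hs : ∀ m, s (m + 1) = c + X * h.eval (s m) := fun m => Function.iterate_succ_apply' _ _ _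
  have hstep : ∀ m, X ^ m ∣ s (m + 1) - s m := by
    intro m
    induction m with
    | zero => simp
    | succ m ih =>
      rw [hs (m + 1), hs m, add_sub_add_left_eq_sub, ← mul_sub, ← hs m, pow_succ']
      exact mul_dvd_mul_left _ (ih.trans (Polynomial.sub_dvd_eval_sub _ _ h))
  have hcauchy : ∀ m n, m ≤ n → X ^ m ∣ s n - s m := by
    intro m n hmn
    induction n, hmn using Nat.le_induction with
    | base => simp
    | succ n hmn ih =>
      rw [← sub_add_sub_cancel]
      exact dvd_add ((pow_dvd_pow X hmn).trans (hstep n)) ih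
  -- the limit of the iterates, whose `j`-th coefficients are constant from index `j + 1` on
  let t : k⟦X⟧ := PowerSeries.mk fun j => coeff j (s (j + 1))
  have ht : ∀ m, X ^ m ∣ s m - t := by
    intro m
    rw [X_pow_dvd_iff]
    intro j hj
    have := X_pow_dvd_iff.mp (hcauchy (j + 1) m hj) j (Nat.lt_succ_self j)
    rw [map_sub] at this ⊢
    simpa [t] using this
  refine ⟨t, sub_eq_zero.mp ?_⟩
  ext j
  have h1 : X ^ (j + 1) ∣ t - (c + X * h.eval t) := by
    have h2 : t - (c + X * h.eval t) = -(s (j + 1) - t) + X * (h.eval (s j) - h.eval t) := by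
      rw [hs]; ring
    rw [h2]
    refine dvd_add ((dvd_neg).mpr (ht _)) ?_
    rw [pow_succ']
    exact mul_dvd_mul_left _ ((ht j).trans (Polynomial.sub_dvd_eval_sub _ _ h))
  simpa using X_pow_dvd_iff.mp h1 j (Nat.lt_succ_self j)

/-- A nonzero power series without constant term is transcendental over the coefficient field. -/
theorem PowerSeries.aeval_injective {k : Type*} [Field k] {t : k⟦X⟧} (ht : X ∣ t) (ht0 : t ≠ 0) :
    Function.Injective (Polynomial.aeval (R := k) t) := by
  refine (injective_iff_map_eq_zero _).mpr fun P hP => ?_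
  by_contra hP0
  obtain ⟨Q, hQ, hdvd⟩ := Polynomial.exists_eq_pow_rootMultiplicity_mul_and_not_dvd P hP0 0
  rw [hQ, map_mul, map_pow, map_sub, Polynomial.aeval_X, Polynomial.aeval_C, map_zero,
    sub_zero] at hP
  have hQ0 := (mul_eq_zero.mp hP).resolve_left (pow_ne_zero _ ht0)
  apply hdvd
  rw [Polynomial.dvd_iff_isRoot, Polynomial.IsRoot]
  have h2 := congrArg constantCoeff hQ0
  rw [Polynomial.aeval_def, Polynomial.hom_eval₂, X_dvd_iff.mp ht, map_zero] at h2
  exact h2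

section WildAut

variable {k : Type*} [Field k] (V : AddSubgroup (Polynomial k)) [Fintype V]

/-- For `z = 1 / s`, the expression `s ^ #V * y * ∏ v, (z - v(y))`. Thus `wildNorm V s y = s ^ #V`
is the equation `∏ v, (z - v(y)) = 1 / y` with denominators cleared, and the product is invariant
under the translations of `z` by `v(y)`, `v ∈ V`. -/
noncomputable def wildNorm (s y : k⟦X⟧) : k⟦X⟧ :=
  y * ∏ v : V, (1 - s * Polynomial.aeval y v.1)

/-- Modulo `s`, `wildNorm V s y` is just `y`; the correction is polynomial in `y`. -/
theorem exists_wildNorm_eq_sub (s : k⟦X⟧) :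
    ∃ h : Polynomial k⟦X⟧, ∀ y, wildNorm V s y = y - s * h.eval y := by
  obtain ⟨h, hh⟩ : Polynomial.C s ∣
      1 - ∏ v : V, (1 - Polynomial.C s * v.1.map (algebraMap k k⟦X⟧)) := by
    refine Finset.prod_induction _ (fun f => Polynomial.C s ∣ 1 - f) ?_ (by simp) ?_
    · intro a b ha hb
      have : 1 - a * b = (1 - a) + a * (1 - b) := by ring
      rw [this]
      exact dvd_add ha (hb.mul_left a)
    · intro v _
      simp
  refine ⟨Polynomial.X * h, fun y => ?_⟩
  have h2 := congrArg (Polynomial.eval y) hh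
  simp only [Polynomial.eval_sub, Polynomial.eval_one, Polynomial.eval_prod, Polynomial.eval_mul,
    Polynomial.eval_C, Polynomial.eval_map_algebraMap] at h2
  rw [wildNorm, Polynomial.eval_mul, Polynomial.eval_X]
  linear_combination (-y) * h2

/-- By uniqueness, an automorphism that preserves the equation defining `t` fixes `t`. -/
theorem wildNorm_injective {s : k⟦X⟧} (hs : X ∣ s) : Function.Injective (wildNorm V s) := by
  intro a b hab
  obtain ⟨h, hh⟩ := exists_wildNorm_eq_sub V s
  obtain ⟨c, hc⟩ := Polynomial.sub_dvd_eval_sub a b h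
  rw [hh, hh] at hab
  have h1 : (a - b) * (1 - s * c) = 0 := by linear_combination hab + s * hc
  refine sub_eq_zero.mp ((mul_eq_zero.mp h1).resolve_right fun h0 => ?_)
  simpa [X_dvd_iff.mp hs] using congrArg constantCoeff h0

/-- With `z = 1 / X`, there is `t` with `∏ v, (z - v(t)) = 1 / t`; the substitutions
`z ↦ z + v(t)` will fix this `t`. -/
theorem exists_wildNorm_X_eq : ∃ t : k⟦X⟧, X ∣ t ∧ t ≠ 0 ∧ wildNorm V X t = X ^ Fintype.card V := by
  obtain ⟨h, hh⟩ := exists_wildNorm_eq_sub V X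
  obtain ⟨t, ht⟩ := PowerSeries.exists_eq_add_X_mul_eval (X ^ Fintype.card V) h
  have hN : wildNorm V X t = X ^ Fintype.card V := by rw [hh]; linear_combination ht
  refine ⟨t, ?_, ?_, hN⟩
  · rw [ht]
    exact dvd_add (dvd_pow_self _ Fintype.card_ne_zero) (dvd_mul_right _ _)
  · rintro rfl
    exact pow_ne_zero _ X_ne_zero (hN.symm.trans (by simp [wildNorm]))

theorem map_wildNorm (S : k⟦X⟧ →ₐ[k] k⟦X⟧) (s y : k⟦X⟧) :
    S (wildNorm V s y) = wildNorm V (S s) (S y) := by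
  simp [wildNorm, Polynomial.aeval_algHom_apply]

/-- The denominator `1 + X v(t)` of the substitution `1 / X ↦ 1 / X + v(t)`. -/
noncomputable def wildDenom (t : k⟦X⟧) (v : Polynomial k) : k⟦X⟧ := 1 + X * Polynomial.aeval t v

theorem wildDenom_mul_inv (t : k⟦X⟧) (v : Polynomial k) :
    wildDenom t v * (wildDenom t v)⁻¹ = 1 :=
  PowerSeries.mul_inv_cancel _ (by simp [wildDenom])

/-- The image `X / (1 + X v(t))` of `X` under the substitution `1 / X ↦ 1 / X + v(t)`. -/
noncomputable def wildParam (t : k⟦X⟧) (v : Polynomial k) : k⟦X⟧ := X * (wildDenom t v)⁻¹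

theorem wildDenom_mul_wildParam (t : k⟦X⟧) (v : Polynomial k) :
    wildDenom t v * wildParam t v = X := by
  rw [wildParam, mul_left_comm, wildDenom_mul_inv, mul_one]

theorem hasSubst_wildParam (t : k⟦X⟧) (v : Polynomial k) : HasSubst (wildParam t v) :=
  HasSubst.of_constantCoeff_zero' (by simp [wildParam])

/-- The substitution `1 / X ↦ 1 / X + v(t)`. -/
noncomputable def wildHom (t : k⟦X⟧) (v : Polynomial k) : k⟦X⟧ →ₐ[k] k⟦X⟧ :=
  substAlgHom (hasSubst_wildParam t v)

theorem wildHom_apply (t : k⟦X⟧) (v : Polynomial k) (f : k⟦X⟧) :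
    wildHom t v f = f.subst (wildParam t v) := by
  rw [wildHom, coe_substAlgHom]

theorem wildHom_X (t : k⟦X⟧) (v : Polynomial k) : wildHom t v X = wildParam t v :=
  substAlgHom_X _

variable {V} {t : k⟦X⟧}

/-- Translation by `v` permutes the factors of `∏ w, (1 / X - w(t))`. -/
theorem wildNorm_wildParam (ht : wildNorm V X t = X ^ Fintype.card V) (v : V) :
    wildNorm V (wildParam t v.1) t = wildParam t v.1 ^ Fintype.card V := by
  have hu := wildDenom_mul_wildParam t v.1
  have hu0 : wildDenom t v.1 ≠ 0 := fun h0 => X_ne_zero (R := k) (by rw [← hu, h0, zero_mul])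
  apply mul_left_cancel₀ (pow_ne_zero (Fintype.card V) hu0)
  rw [← mul_pow, hu, ← ht, wildNorm, wildNorm, mul_left_comm]
  congr 1
  have : wildDenom t v.1 ^ Fintype.card V = ∏ _w : V, wildDenom t v.1 := by simp
  rw [this, ← Finset.prod_mul_distrib]
  refine Fintype.prod_equiv (Equiv.subRight v) _ _ fun w => ?_
  rw [mul_sub, mul_one, ← mul_assoc, hu, Equiv.subRight_apply, AddSubgroup.coe_sub, map_sub,
    wildDenom]
  ring

theorem wildHom_fixed (ht : wildNorm V X t = X ^ Fintype.card V) (v : V) :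
    wildHom t v.1 t = t := by
  apply wildNorm_injective V (s := wildParam t v.1) (dvd_mul_right _ _)
  rw [wildNorm_wildParam ht, ← wildHom_X, ← map_wildNorm, ht, map_pow]

/-- As `t` is fixed, the substitutions compose by adding the translations. -/
theorem wildHom_wildParam (ht : wildNorm V X t = X ^ Fintype.card V) (v w : V) :
    wildHom t v.1 (wildParam t w.1) = wildParam t (v.1 + w.1) := by
  have h1 : wildDenom t (v.1 + w.1) = wildDenom t v.1 * wildHom t v.1 (wildDenom t w.1) := by
    have h2 : wildHom t v.1 (wildDenom t w.1) = 1 + wildParam t v.1 * Polynomial.aeval t w.1 := by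
      rw [wildDenom, map_add, map_one, map_mul, wildHom_X, ← Polynomial.aeval_algHom_apply,
        wildHom_fixed ht]
    rw [h2, mul_add, mul_one, ← mul_assoc, wildDenom_mul_wildParam, wildDenom, wildDenom, map_add]
    ring
  have hu := wildDenom_mul_wildParam t (v.1 + w.1)
  have hu0 : wildDenom t (v.1 + w.1) ≠ 0 := fun h0 =>
    X_ne_zero (R := k) (by rw [← hu, h0, zero_mul])
  apply mul_left_cancel₀ hu0
  rw [hu, h1, mul_assoc, ← map_mul, wildDenom_mul_wildParam, wildHom_X, wildDenom_mul_wildParam]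

/-- The group `V` acting on `k⟦X⟧` by the substitutions `1 / X ↦ 1 / X + v(t)`. -/
noncomputable def wildEnd (ht : wildNorm V X t = X ^ Fintype.card V) :
    Multiplicative V →* (k⟦X⟧ →ₐ[k] k⟦X⟧) where
  toFun v := wildHom t v.toAdd.1
  map_one' := by
    have : wildParam t 0 = X := by simpa [wildDenom] using wildDenom_mul_wildParam t 0
    ext1 f
    rw [wildHom_apply, toAdd_one, AddSubgroup.coe_zero, this, X_subst, AlgHom.one_apply]
  map_mul' v w := by
    ext1 f
    rw [AlgHom.mul_apply, wildHom_apply t w.toAdd.1, wildHom_apply t v.toAdd.1,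
      subst_comp_subst_apply (hasSubst_wildParam _ _) (hasSubst_wildParam _ _), ← wildHom_apply,
      wildHom_wildParam ht, wildHom_apply]
    rfl

theorem wildEnd_injective (hXt : X ∣ t) (ht0 : t ≠ 0)
    (ht : wildNorm V X t = X ^ Fintype.card V) : Function.Injective (wildEnd ht) := by
  intro v w h
  have h1 : wildParam t v.toAdd.1 = wildParam t w.toAdd.1 := by
    rw [← wildHom_X, ← wildHom_X]
    exact DFunLike.congr_fun h X
  have h2 : wildDenom t v.toAdd.1 = wildDenom t w.toAdd.1 := by
    have hv := wildDenom_mul_wildParam t v.toAdd.1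
    have hw := wildDenom_mul_wildParam t w.toAdd.1
    rw [← hw, h1] at hv
    refine mul_right_cancel₀ (fun h0 => X_ne_zero (R := k) ?_) hv
    rw [← hw, h0, mul_zero]
  have h3 := mul_left_cancel₀ X_ne_zero (add_left_cancel h2)
  exact Subtype.ext (PowerSeries.aeval_injective hXt ht0 h3)

end WildAut

/-- The polynomials of degree less than `a` form an additive group of order `#k ^ a`, which acts
faithfully on `k⟦X⟧` by the substitutions `1 / X ↦ 1 / X + v(t)`. -/
theorem exists_subfield_finrank_eq_pow (k : Type*) [Field k] [Finite k] (a : ℕ) :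
    ∃ K' : Subfield (LaurentSeries k), FiniteDimensional K' (LaurentSeries k) ∧
      IsGalois K' (LaurentSeries k) ∧
      Module.finrank K' (LaurentSeries k) = Nat.card k ^ a := by
  let V := (Polynomial.degreeLT k a).toAddSubgroup
  have e : V ≃ (Fin a → k) := (Polynomial.degreeLTEquiv k a).toEquiv
  have : Finite V := Finite.of_equiv _ e.symm
  have := Fintype.ofFinite V
  obtain ⟨t, hXt, ht0, ht⟩ := exists_wildNorm_X_eq V
  let φ : Multiplicative V →* RingAut k⟦X⟧ :=
    (MulSemiringAction.toRingAut (k⟦X⟧ ≃ₐ[k] k⟦X⟧) k⟦X⟧).comp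
      ((AlgEquiv.algHomUnitsEquiv k k⟦X⟧).toMonoidHom.comp (wildEnd ht).toHomUnits)
  have hφ : Function.Injective φ := fun v w h =>
    wildEnd_injective hXt ht0 ht (AlgHom.ext (RingEquiv.congr_fun h))
  obtain ⟨K', h1, h2, h3⟩ := exists_subfield_finrank_eq_card φ hφ
  refine ⟨K', h1, h2, h3.trans ?_⟩
  rw [Nat.card_congr (Multiplicative.toAdd.trans e), Nat.card_fun, Nat.card_fin]

/-! ### Prime powers dividing degrees of finite Galois extensions -/

theorem mainTheorem9 (p : ℕ) [Fact p.Prime] (i : ℕ) (hi : 0 < i)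
    (q : ℕ) (hq : q.Prime) (a : ℕ) :
    (∃ K' : Subfield (LaurentSeries (GaloisField p i)),
        FiniteDimensional K' (LaurentSeries (GaloisField p i)) ∧
        IsGalois K' (LaurentSeries (GaloisField p i)) ∧
        q ^ a ∣ Module.finrank K' (LaurentSeries (GaloisField p i))) ↔
      (q = p ∨ q ^ a ∣ i * (p ^ i - 1)) := by
  have hk : Nat.card (GaloisField p i) = p ^ i := GaloisField.card p i hi.ne'
  constructor
  · rintro ⟨K', h1, h2, h3⟩
    exact or_iff_not_imp_left.mpr fun hqp => pow_dvd_of_isGalois hk hq hqp K' h3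
  · rintro (rfl | h)
    · obtain ⟨K', h1, h2, h3⟩ := exists_subfield_finrank_eq_pow (GaloisField q i) a
      refine ⟨K', h1, h2, ?_⟩
      rw [h3, hk]
      exact pow_dvd_pow_of_dvd (dvd_pow_self q hi.ne') a
    · obtain ⟨K', h1, h2, h3⟩ := exists_subfield_finrank_eq_mul hk
      exact ⟨K', h1, h2, h3 ▸ h⟩
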